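/- Let $H$ be a hypergraph on a finite vertex set $V(H)$, that is, a collection of nonempty subsets (edges) of $V(H)$. Let $I(H)$ be its independence complex, the simplicial complex of all subsets of $V(H)$ that contain no edge of $H$. Let $e=\{v_1,\dots,v_k\}$ be an edge of $H$ (with $v_1,\dots,v_k$ distinct), and let $H_e$ be the hypergraph on $V(H)\sqcup\{w,u_1,\dots,u_k\}$, where $w,u_1,\dots,u_k$ are distinct new vertices, with edge set $$H_e=(H\setminus\{e\})\cup\{\{w,u_i\} : 1\le i\le k\}\cup\{\{u_i,v_i\} : 1\le i\le k\}.$$ Then $I(H_e)\simeq\Sigma I(H)$, i.e. the geometric realization of $I(H_e)$ is homotopy equivalent to the suspension of the geometric realization of $I(H)$. Here $\Sigma X$ is the unreduced suspension, obtained from $X\times[0,1]$ by collapsing each of $X\times\{0\}$ and $X\times\{1\}$ to a point, with the convention that $\Sigma\varnothing$ is the two-point space $S^0$. -/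

import Mathlib

/-- The independence complex `I(H)` of a hypergraph `H`: its faces are the nonempty finite sets of
vertices of `H` that contain no edge of `H`. (Mathlib's complexes do not list the empty face.) -/
def Hypergraph.independenceComplex {α : Type*} (H : Hypergraph α) :
    PreAbstractSimplicialComplex α where
  faces := {W | W.Nonempty ∧ (W : Set α) ⊆ H.vertexSet ∧ ∀ f ∈ H.edgeSet, ¬ f ⊆ (W : Set α)}
  isRelLowerSet_faces := by
    rintro W ⟨hne, hV, hind⟩
    refine ⟨hne, fun T hTW hT => ⟨hT, fun x hx => hV (hTW hx), fun f hf hfT => ?_⟩⟩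
    exact hind f hf (hfT.trans (fun x hx => hTW hx))

/-- The vertices of `H_e`: the old ones, the hub `w`, and a spoke `u v` for each vertex `v`
(only the spokes `u v` with `v ∈ e` belong to the vertex set of `H_e`). -/
inductive EdgeExpansionVertex (α : Type*) : Type _
  | old (v : α) : EdgeExpansionVertex α
  | w : EdgeExpansionVertex α
  | u (v : α) : EdgeExpansionVertex α

open EdgeExpansionVertex in
/-- The hypergraph `H_e` obtained from `H` by deleting the edge `e`, adding new vertices `w` and
`u v` for `v ∈ e`, and adding the new edges `{w, u v}` and `{u v, v}` for `v ∈ e`. -/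
def Hypergraph.edgeExpansion {α : Type*} (H : Hypergraph α) (e : Set α) :
    Hypergraph (EdgeExpansionVertex α) where
  vertexSet := old '' H.vertexSet ∪ {w} ∪ u '' (e ∩ H.vertexSet)
  edgeSet := {g | (∃ f ∈ H.edgeSet, f ≠ e ∧ g = old '' f) ∨
    (∃ v ∈ e ∩ H.vertexSet, g = {w, u v}) ∨ (∃ v ∈ e ∩ H.vertexSet, g = {u v, old v})}
  subset_vertexSet_of_mem_edgeSet' := by
    rintro g (⟨f, hf, -, rfl⟩ | ⟨v, hv, rfl⟩ | ⟨v, hv, rfl⟩)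
    · rintro _ ⟨x, hx, rfl⟩
      exact Or.inl (Or.inl ⟨x, H.subset_vertexSet_of_mem_edgeSet' hf hx, rfl⟩)
    · rintro x (rfl | rfl)
      · exact Or.inl (Or.inr rfl)
      · exact Or.inr ⟨v, hv, rfl⟩
    · rintro x (rfl | rfl)
      · exact Or.inr ⟨v, hv, rfl⟩
      · exact Or.inl (Or.inl ⟨v, hv.2, rfl⟩)

/-- The geometric realization of a simplicial complex with finitely many vertices, in barycentric
coordinates: the union of the closed simplices spanned by the faces, as a set of functions
`α → ℝ`, with the subspace topology. -/
def PreAbstractSimplicialComplex.realization {α : Type*} (K : PreAbstractSimplicialComplex α) :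
    Set (α → ℝ) :=
  {x | (∀ v, 0 ≤ x v) ∧ ∃ s ∈ K.faces, (∀ v, v ∉ s → x v = 0) ∧ ∑ v ∈ s, x v = 1}

/-- The gluing of `X × [0,1]` to two points `false` and `true`: the bottom `X × {0}` is glued
to `false` and the top `X × {1}` to `true`. -/
inductive SuspensionRel (X : Type*) : (X × unitInterval) ⊕ Bool → (X × unitInterval) ⊕ Bool → Prop
  | bottom (x : X) : SuspensionRel X (Sum.inl (x, 0)) (Sum.inr false)
  | top (x : X) : SuspensionRel X (Sum.inl (x, 1)) (Sum.inr true)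

/-- The (unreduced) suspension of a topological space: `X × [0,1]` with each of `X × {0}` and
`X × {1}` collapsed to one point. The two poles are present also when `X` is empty, so the
suspension of the empty space is the two-point sphere. -/
def Suspension (X : Type*) : Type _ := Quot (SuspensionRel X)

instance Suspension.instTopologicalSpace (X : Type*) [TopologicalSpace X] :
    TopologicalSpace (Suspension X) :=
  inferInstanceAs (TopologicalSpace (Quot (SuspensionRel X)))

/-!
The independence complex of `H_e` is the union of two contractible pieces: the cone with apex the
hub `w` over the complex of `H` without `e`, and the faces that avoid `w` and do not contain `e`
among the old vertices. The two meet exactly in `I(H)`, hence a suspension. Instead of gluing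
along cofibrations, the proof writes down both maps and both homotopies in barycentric coordinates.

A point of `|I(H_e)|` consists of a weight `c` at `w`, weights `b v` at the old vertices and
weights `a v` at the spokes. Since `a v * b v = 0`, the last two are the negative and positive
parts of a single function `b - a`. The suspension of `|I(H)|` is the set of pairs `(b, h)`
with `|h| ≤ 1`, `b` in the cone over `|I(H)|` and total mass `1 - |h|`
(`Hypergraph.nonempty_homeomorph_suspensionModel`).

* To the suspension (`Hypergraph.toSuspension`): subtract from `b` its minimum `m` over `e`, move
  the removed mass to the hub (which pushes the faces containing `e` towards `w`), and take as
  height the mass of `a` minus the mass at the hub. This is a point of the model because spokes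
  and hub never carry mass together, and `m = 0` as soon as a spoke carries mass.
* From the suspension (`Hypergraph.ofSuspension`): for `h ≤ 0` put `-h` on the hub, for `h ≥ 0`
  replace `b` by `b - h` on `e`, read negative values as weights of spokes, and normalize. The
  result is nonzero because `b` vanishes somewhere on `e`.

One composite is joined to the identity by segments in the model
(`Hypergraph.segment_mem_suspensionModel`), the other by normalized segments in the coordinates
`(c, b - a)` (`Hypergraph.expansionPath`); neither kind of segment enlarges the support of `b`.
-/

/-! ### The realization as a slice of a cone -/

/-- The cone over the realization of the independence complex of `H`: the nonnegative functions
on the vertices whose support contains no edge of `H`, the zero function included. -/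
def Hypergraph.faceCone {α : Type*} (H : Hypergraph α) : Set (α → ℝ) :=
  {x | (∀ v, 0 ≤ x v) ∧ (∀ v, v ∉ H.vertexSet → x v = 0) ∧ ∀ f ∈ H.edgeSet, ∃ v ∈ f, x v = 0}

namespace Hypergraph

theorem mem_realization_independenceComplex_iff {α : Type*} {H : Hypergraph α} {V : Finset α}
    (hV : (V : Set α) = H.vertexSet) {x : α → ℝ} :
    x ∈ H.independenceComplex.realization ↔ x ∈ H.faceCone ∧ ∑ v ∈ V, x v = 1 := by
  classical
  constructor
  · rintro ⟨h0, s, ⟨-, hsV, hs⟩, hzero, hsum⟩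
    have hsub : s ⊆ V := fun v hv => by
      have := hsV hv
      rwa [← hV] at this
    refine ⟨⟨h0, fun v hv => hzero v fun h => hv (hsV h), fun f hf => ?_⟩, ?_⟩
    · obtain ⟨v, hvf, hvs⟩ := Set.not_subset.1 (hs f hf)
      exact ⟨v, hvf, hzero v hvs⟩
    · rw [← hsum]
      exact (Finset.sum_subset hsub fun v _ hv => hzero v hv).symm
  · rintro ⟨⟨h0, hoff, hedge⟩, hsum⟩
    have hmem : ∀ v, v ∉ V.filter (fun v => x v ≠ 0) → x v = 0 := by
      intro v hv
      by_contra hne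
      refine hv (Finset.mem_filter.2 ⟨?_, hne⟩)
      by_contra hvV
      exact hne (hoff v (by rwa [← hV]))
    have hsum' : ∑ v ∈ V.filter (fun v => x v ≠ 0), x v = 1 := by
      rw [← hsum]
      exact Finset.sum_filter_ne_zero V
    refine ⟨h0, V.filter (fun v => x v ≠ 0), ⟨?_, ?_, ?_⟩, hmem, hsum'⟩
    · rw [Finset.nonempty_iff_ne_empty]
      intro h
      rw [h] at hsum'
      simp at hsum'
    · intro v hv
      rw [← hV]
      exact (Finset.mem_filter.1 hv).1
    · intro f hf hsub
      obtain ⟨v, hv, hxv⟩ := hedge f hf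
      exact (Finset.mem_filter.1 (hsub hv)).2 hxv

theorem smul_mem_faceCone {α : Type*} {H : Hypergraph α} {x : α → ℝ} (hx : x ∈ H.faceCone)
    {c : ℝ} (hc : 0 ≤ c) : c • x ∈ H.faceCone := by
  refine ⟨fun v => mul_nonneg hc (hx.1 v), fun v hv => ?_, fun f hf => ?_⟩
  · simp [hx.2.1 v hv]
  · obtain ⟨v, hv, h⟩ := hx.2.2 f hf
    exact ⟨v, hv, by simp [h]⟩

/-- Shrinking the support (in particular decreasing a function) stays inside the cone. -/
theorem mem_faceCone_of_support {α : Type*} {H : Hypergraph α} {x y : α → ℝ}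
    (hx : x ∈ H.faceCone) (hy : ∀ v, 0 ≤ y v) (h : ∀ v, x v = 0 → y v = 0) : y ∈ H.faceCone :=
  ⟨hy, fun v hv => h v (hx.2.1 v hv), fun f hf =>
    let ⟨v, hv, hxv⟩ := hx.2.2 f hf
    ⟨v, hv, h v hxv⟩⟩

theorem normalize_mem_realization {α : Type*} {H : Hypergraph α} {V : Finset α}
    (hV : (V : Set α) = H.vertexSet) {x : α → ℝ} (hx : x ∈ H.faceCone)
    (hpos : 0 < ∑ v ∈ V, x v) :
    (∑ v ∈ V, x v)⁻¹ • x ∈ H.independenceComplex.realization := by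
  refine (mem_realization_independenceComplex_iff hV).2
    ⟨smul_mem_faceCone hx (inv_nonneg.2 hpos.le), ?_⟩
  simp only [Pi.smul_apply, smul_eq_mul, ← Finset.mul_sum]
  exact inv_mul_cancel₀ hpos.ne'

theorem eq_zero_of_sum_eq_zero {α : Type*} {H : Hypergraph α} {V : Finset α}
    (hV : (V : Set α) = H.vertexSet) {x : α → ℝ} (hx : x ∈ H.faceCone)
    (h : ∑ v ∈ V, x v = 0) : x = 0 := by
  funext v
  by_cases hv : v ∈ V
  · exact (Finset.sum_eq_zero_iff_of_nonneg fun v _ => hx.1 v).1 h v hv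
  · exact hx.2.1 v (by rwa [← hV])

theorem isClosed_faceCone {α : Type*} {H : Hypergraph α} (hfin : H.vertexSet.Finite) :
    IsClosed H.faceCone := by
  have h1 : IsClosed {x : α → ℝ | ∀ v, 0 ≤ x v} := by
    rw [Set.ofPred_forall]
    exact isClosed_iInter fun v => isClosed_le continuous_const (continuous_apply v)
  have h2 : IsClosed {x : α → ℝ | ∀ v, v ∉ H.vertexSet → x v = 0} := by
    simp only [Set.ofPred_forall]
    exact isClosed_iInter fun v => isClosed_iInter fun _ =>
      isClosed_eq (continuous_apply v) continuous_const
  have h3 : IsClosed {x : α → ℝ | ∀ f ∈ H.edgeSet, ∃ v ∈ f, x v = 0} := by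
    simp only [Set.ofPred_forall]
    refine isClosed_iInter fun f => isClosed_iInter fun hf => ?_
    have : {x : α → ℝ | ∃ v ∈ f, x v = 0} = ⋃ v ∈ f, {x | x v = 0} := by
      ext x
      simp
    rw [this]
    exact (hfin.subset (H.subset_vertexSet_of_mem_edgeSet' hf)).isClosed_biUnion fun v _ =>
      isClosed_eq (continuous_apply v) continuous_const
  exact h1.inter (h2.inter h3)

theorem isCompact_realization_independenceComplex {α : Type*} {H : Hypergraph α}
    {V : Finset α} (hV : (V : Set α) = H.vertexSet) :
    IsCompact H.independenceComplex.realization := by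
  have heq : H.independenceComplex.realization = H.faceCone ∩ {x | ∑ v ∈ V, x v = 1} :=
    Set.ext fun x => mem_realization_independenceComplex_iff hV
  have hclosed : IsClosed H.independenceComplex.realization := by
    rw [heq]
    exact (isClosed_faceCone (hV ▸ V.finite_toSet)).inter
      (isClosed_eq (by fun_prop) continuous_const)
  refine (isCompact_univ_pi fun _ : α => isCompact_Icc (a := (0 : ℝ)) (b := 1)).of_isClosed_subset
    hclosed fun x hx v _ => ?_
  obtain ⟨hx, hsum⟩ := (mem_realization_independenceComplex_iff hV).1 hx
  refine ⟨hx.1 v, ?_⟩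
  by_cases hv : v ∈ V
  · rw [← hsum]
    exact Finset.single_le_sum (fun v _ => hx.1 v) hv
  · rw [hx.2.1 v (by rwa [← hV])]
    exact zero_le_one

/-! ### The suspension in coordinates -/

/-- A model of the suspension of the realization of the independence complex inside
`(α → ℝ) × ℝ`: the pairs `(b, h)` of a height `h ∈ [-1, 1]` and a point `b` of the cone over the
realization with total mass `1 - |h|`. The poles are `(0, -1)` and `(0, 1)`. -/
def suspensionModel {α : Type*} (H : Hypergraph α) (V : Finset α) : Set ((α → ℝ) × ℝ) :=
  {p | p.1 ∈ H.faceCone ∧ ∑ v ∈ V, p.1 v = 1 - |p.2|}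

theorem zero_mem_faceCone {α : Type*} {H : Hypergraph α} (hne : ∅ ∉ H.edgeSet) :
    (0 : α → ℝ) ∈ H.faceCone := by
  refine ⟨fun _ => le_rfl, fun _ _ => rfl, fun f hf => ?_⟩
  obtain ⟨v, hv⟩ := Set.nonempty_iff_ne_empty.2 fun h => hne (h ▸ hf)
  exact ⟨v, hv, rfl⟩

/-- The map from the cylinder and the two poles to `Hypergraph.suspensionModel` that scales the
slice of parameter `t` by `1 - |2 t - 1|`. -/
def suspensionCoords {α : Type*} (X : Set (α → ℝ)) : (X × unitInterval) ⊕ Bool → (α → ℝ) × ℝ :=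
  Sum.elim (fun p => ((1 - |2 * (p.2 : ℝ) - 1|) • (p.1 : α → ℝ), 2 * (p.2 : ℝ) - 1))
    (fun i => (0, if i then 1 else -1))

theorem continuous_suspensionCoords {α : Type*} (X : Set (α → ℝ)) :
    Continuous (suspensionCoords X) := by
  refine Continuous.sumElim ?_ continuous_of_discreteTopology
  fun_prop

theorem suspensionCoords_mem {α : Type*} {H : Hypergraph α} {V : Finset α}
    (hV : (V : Set α) = H.vertexSet) (hne : ∅ ∉ H.edgeSet)
    (z : (H.independenceComplex.realization × unitInterval) ⊕ Bool) :
    suspensionCoords _ z ∈ H.suspensionModel V := by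
  rcases z with ⟨⟨y, hy⟩, t, ht0, ht1⟩ | i
  · obtain ⟨hy, hsum⟩ := (mem_realization_independenceComplex_iff hV).1 hy
    have hc : 0 ≤ 1 - |2 * t - 1| := by
      rw [sub_nonneg, abs_le]
      constructor <;> linarith
    refine ⟨smul_mem_faceCone hy hc, ?_⟩
    simp only [suspensionCoords, Sum.elim_inl, Pi.smul_apply, smul_eq_mul, ← Finset.mul_sum,
      hsum, mul_one]
  · refine ⟨zero_mem_faceCone hne, ?_⟩
    cases i <;> simp [suspensionCoords]

theorem suspensionCoords_eq_of_rel {α : Type*} {X : Set (α → ℝ)}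
    {a b : (X × unitInterval) ⊕ Bool} (h : SuspensionRel X a b) :
    suspensionCoords X a = suspensionCoords X b := by
  cases h with
  | bottom x => simp [suspensionCoords]
  | top x =>
    simp only [suspensionCoords, Sum.elim_inl, Sum.elim_inr, Set.Icc.coe_one]
    norm_num

theorem mk_eq_mk_of_suspensionCoords_eq {α : Type*} {X : Set (α → ℝ)}
    {a b : (X × unitInterval) ⊕ Bool} (h : suspensionCoords X a = suspensionCoords X b) :
    Quot.mk (SuspensionRel X) a = Quot.mk (SuspensionRel X) b := by
  -- A point of the cylinder with extreme height is identified with a pole.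
  have pole0 : ∀ (y : X) (t : unitInterval), (t : ℝ) = 0 →
      Quot.mk (SuspensionRel X) (Sum.inl (y, t)) = Quot.mk _ (Sum.inr false) := by
    intro y t ht
    obtain rfl : t = 0 := Subtype.ext ht
    exact Quot.sound (.bottom y)
  have pole1 : ∀ (y : X) (t : unitInterval), (t : ℝ) = 1 →
      Quot.mk (SuspensionRel X) (Sum.inl (y, t)) = Quot.mk _ (Sum.inr true) := by
    intro y t ht
    obtain rfl : t = 1 := Subtype.ext ht
    exact Quot.sound (.top y)
  have hh := congrArg Prod.snd h
  rcases a with ⟨y, t⟩ | i <;> rcases b with ⟨y', t'⟩ | j <;>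
    simp only [suspensionCoords, Sum.elim_inl, Sum.elim_inr] at hh
  · have htt : t = t' := Subtype.ext (by linarith)
    subst htt
    rcases eq_or_ne (t : ℝ) 0 with h0 | h0
    · rw [pole0 y t h0, pole0 y' t h0]
    rcases eq_or_ne (t : ℝ) 1 with h1 | h1
    · rw [pole1 y t h1, pole1 y' t h1]
    have h0' : 0 < (t : ℝ) := lt_of_le_of_ne t.2.1 h0.symm
    have h1' : (t : ℝ) < 1 := lt_of_le_of_ne t.2.2 h1
    have hc : 1 - |2 * (t : ℝ) - 1| ≠ 0 := by
      have : |2 * (t : ℝ) - 1| < 1 := abs_lt.2 ⟨by linarith, by linarith⟩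
      linarith
    have hy : y = y' := Subtype.ext (smul_right_injective _ hc (congrArg Prod.fst h))
    rw [hy]
  · cases j
    · exact pole0 y t (by simp at hh; simp [hh])
    · exact pole1 y t (by simp at hh; linarith)
  · cases i
    · exact (pole0 y' t' (by simp at hh; linarith)).symm
    · exact (pole1 y' t' (by simp at hh; linarith)).symm
  · cases i <;> cases j <;> first | rfl | (norm_num at hh)

theorem exists_suspensionCoords_eq {α : Type*} {H : Hypergraph α} {V : Finset α}
    (hV : (V : Set α) = H.vertexSet) {p : (α → ℝ) × ℝ} (hp : p ∈ H.suspensionModel V) :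
    ∃ z, suspensionCoords H.independenceComplex.realization z = p := by
  obtain ⟨b, h⟩ := p
  obtain ⟨hb, hsum⟩ := hp
  simp only at hb hsum
  have hle : |h| ≤ 1 := by
    have := Finset.sum_nonneg fun v (_ : v ∈ V) => hb.1 v
    linarith
  rcases hle.eq_or_lt with h1 | h1
  · have hb0 : b = 0 := eq_zero_of_sum_eq_zero hV hb (by rw [hsum, h1, sub_self])
    rcases eq_or_eq_neg_of_abs_eq h1 with rfl | rfl
    · exact ⟨Sum.inr true, by simp [suspensionCoords, hb0]⟩
    · exact ⟨Sum.inr false, by simp [suspensionCoords, hb0]⟩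
  · have hpos : 0 < ∑ v ∈ V, b v := by linarith
    obtain ⟨hl, hr⟩ := abs_le.1 hle
    refine ⟨Sum.inl (⟨_, normalize_mem_realization hV hb hpos⟩,
      ⟨(1 + h) / 2, by linarith, by linarith⟩), ?_⟩
    have ht : 2 * ((1 + h) / 2) - 1 = h := by ring
    simp only [suspensionCoords, Sum.elim_inl, ht, ← hsum, smul_inv_smul₀ hpos.ne']

/-- The suspension of the realization is homeomorphic to its coordinate model: it is compact and
the model is Hausdorff, so a continuous bijection suffices. -/
theorem nonempty_homeomorph_suspensionModel {α : Type*} {H : Hypergraph α} {V : Finset α}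
    (hV : (V : Set α) = H.vertexSet) (hne : ∅ ∉ H.edgeSet) :
    Nonempty (Suspension H.independenceComplex.realization ≃ₜ H.suspensionModel V) := by
  have : CompactSpace H.independenceComplex.realization :=
    isCompact_iff_compactSpace.1 (isCompact_realization_independenceComplex hV)
  have : CompactSpace (Suspension H.independenceComplex.realization) :=
    inferInstanceAs (CompactSpace (Quot _))
  let F : Suspension H.independenceComplex.realization → H.suspensionModel V :=
    Quot.lift (fun z => ⟨suspensionCoords _ z, suspensionCoords_mem hV hne z⟩)
      fun a b h => Subtype.ext (suspensionCoords_eq_of_rel h)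
  have hF : Continuous F :=
    continuous_quot_lift _ ((continuous_suspensionCoords _).subtype_mk _)
  have hinj : Function.Injective F := by
    rintro ⟨a⟩ ⟨b⟩ h
    exact mk_eq_mk_of_suspensionCoords_eq (congrArg Subtype.val h)
  have hsurj : Function.Surjective F := by
    rintro ⟨p, hp⟩
    obtain ⟨z, hz⟩ := exists_suspensionCoords_eq hV hp
    exact ⟨Quot.mk _ z, Subtype.ext hz⟩
  exact ⟨Continuous.homeoOfEquivCompactToT2 (f := Equiv.ofBijective F ⟨hinj, hsurj⟩) hF⟩

/-! ### Coordinates on the edge expansion -/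

theorem mem_faceCone_edgeExpansion_iff {α : Type*} {H : Hypergraph α} {E : Finset α}
    (hE : (E : Set α) ∈ H.edgeSet) {x : EdgeExpansionVertex α → ℝ} :
    x ∈ (H.edgeExpansion E).faceCone ↔ (∀ y, 0 ≤ x y) ∧
      (∀ v, v ∉ H.vertexSet → x (.old v) = 0) ∧ (∀ v, v ∉ E → x (.u v) = 0) ∧
      (∀ f ∈ H.edgeSet, f ≠ E → ∃ v ∈ f, x (.old v) = 0) ∧
      (∀ v ∈ E, x .w = 0 ∨ x (.u v) = 0) ∧ (∀ v ∈ E, x (.u v) = 0 ∨ x (.old v) = 0) := by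
  have hEV : ∀ v ∈ E, v ∈ H.vertexSet := fun v hv => H.subset_vertexSet_of_mem_edgeSet' hE hv
  constructor
  · rintro ⟨h0, hoff, hedge⟩
    refine ⟨h0, fun v hv => hoff _ ?_, fun v hv => hoff _ ?_, fun f hf hfe => ?_,
      fun v hv => ?_, fun v hv => ?_⟩
    · rintro ((⟨v', hv', h⟩ | h) | ⟨v', hv', h⟩)
      · cases h; exact hv hv'
      · cases h
      · cases h
    · rintro ((⟨v', hv', h⟩ | h) | ⟨v', hv', h⟩)
      · cases h
      · cases h
      · cases h; exact hv hv'.1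
    · obtain ⟨_, ⟨v, hv, rfl⟩, h⟩ := hedge _ (Or.inl ⟨f, hf, hfe, rfl⟩)
      exact ⟨v, hv, h⟩
    · obtain ⟨_, rfl | rfl, h⟩ := hedge _ (Or.inr (Or.inl ⟨v, ⟨hv, hEV v hv⟩, rfl⟩))
      · exact Or.inl h
      · exact Or.inr h
    · obtain ⟨_, rfl | rfl, h⟩ := hedge _ (Or.inr (Or.inr ⟨v, ⟨hv, hEV v hv⟩, rfl⟩))
      · exact Or.inl h
      · exact Or.inr h
  · rintro ⟨h0, hold, hu, hedge, hw, huv⟩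
    refine ⟨h0, ?_, ?_⟩
    · rintro (v | _ | v) hv
      · exact hold v fun h => hv (Or.inl (Or.inl ⟨v, h, rfl⟩))
      · exact absurd (Or.inl (Or.inr rfl)) hv
      · exact hu v fun h => hv (Or.inr ⟨v, ⟨h, hEV v h⟩, rfl⟩)
    · rintro _ (⟨f, hf, hfe, rfl⟩ | ⟨v, hv, rfl⟩ | ⟨v, hv, rfl⟩)
      · obtain ⟨v, hv, h⟩ := hedge f hf hfe
        exact ⟨_, ⟨v, hv, rfl⟩, h⟩
      · rcases hw v hv.1 with h | h
        · exact ⟨_, Or.inl rfl, h⟩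
        · exact ⟨_, Or.inr rfl, h⟩
      · rcases huv v hv.1 with h | h
        · exact ⟨_, Or.inl rfl, h⟩
        · exact ⟨_, Or.inr rfl, h⟩

theorem exists_finset_vertexSet_edgeExpansion {α : Type*} {H : Hypergraph α} {V E : Finset α}
    (hV : (V : Set α) = H.vertexSet) (hE : (E : Set α) ∈ H.edgeSet) :
    ∃ W : Finset (EdgeExpansionVertex α), (W : Set _) = (H.edgeExpansion E).vertexSet ∧
      ∀ x : EdgeExpansionVertex α → ℝ,
        ∑ y ∈ W, x y = ∑ v ∈ V, x (.old v) + x .w + ∑ v ∈ E, x (.u v) := by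
  classical
  refine ⟨V.image .old ∪ {.w} ∪ E.image .u, ?_, fun x => ?_⟩
  · have : (E : Set α) ∩ H.vertexSet = E :=
      Set.inter_eq_left.2 (H.subset_vertexSet_of_mem_edgeSet' hE)
    simp only [edgeExpansion, Finset.coe_union, Finset.coe_image, Finset.coe_singleton, hV, this]
  · rw [Finset.sum_union, Finset.sum_union, Finset.sum_image, Finset.sum_image,
      Finset.sum_singleton]
    · intro a _ b _ h
      cases h; rfl
    · intro a _ b _ h
      cases h; rfl
    · simp
    · rw [Finset.disjoint_left]
      intro y hy hy'
      obtain ⟨v, -, rfl⟩ := Finset.mem_image.1 hy'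
      simp at hy

/-- The function on the vertices of the edge expansion that encodes a weight `c` at the hub and a
signed function `b - d` on the old vertices: its positive part sits on the old vertices, its
negative part on the spokes. As only one of the two parts is nonzero at each `v`, the edges
`{u v, v}` are respected automatically. -/
def hubSplit {α : Type*} (c : ℝ) (b d : α → ℝ) : EdgeExpansionVertex α → ℝ
  | .old v => max (b v - d v) 0
  | .w => c
  | .u v => max (d v - b v) 0

theorem hubSplit_mem_faceCone {α : Type*} {H : Hypergraph α} {E : Finset α}
    (hE : (E : Set α) ∈ H.edgeSet) {c : ℝ} {b d : α → ℝ} (hc : 0 ≤ c) (hb : ∀ v, 0 ≤ b v)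
    (hd : ∀ v, 0 ≤ d v) (hbV : ∀ v, v ∉ H.vertexSet → b v = 0) (hdE : ∀ v, v ∉ E → d v = 0)
    (hedge : ∀ f ∈ H.edgeSet, f ≠ E → ∃ v ∈ f, b v = 0) (hcd : c = 0 ∨ ∀ v, d v ≤ b v) :
    hubSplit c b d ∈ (H.edgeExpansion E).faceCone := by
  refine (mem_faceCone_edgeExpansion_iff hE).2 ⟨?_, fun v hv => ?_, fun v hv => ?_,
    fun f hf hfe => ?_, fun v _ => ?_, fun v _ => ?_⟩
  · rintro (v | _ | v)
    · exact le_max_right _ _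
    · exact hc
    · exact le_max_right _ _
  · exact max_eq_right (by linarith [hbV v hv, hd v])
  · exact max_eq_right (by linarith [hdE v hv, hb v])
  · obtain ⟨v, hv, h⟩ := hedge f hf hfe
    exact ⟨v, hv, max_eq_right (by linarith [hd v])⟩
  · exact hcd.imp id fun h => max_eq_right (by linarith [h v])
  · rcases le_total (d v) (b v) with h | h
    · exact Or.inl (max_eq_right (by linarith))
    · exact Or.inr (max_eq_right (by linarith))

theorem hubSplit_sum_pos {α : Type*} {V E : Finset α} {c : ℝ} {b d : α → ℝ} (hc : 0 ≤ c)
    {v : α} (hv : v ∈ E) (h : b v < d v) :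
    0 < ∑ v ∈ V, hubSplit c b d (.old v) + hubSplit c b d .w +
      ∑ v ∈ E, hubSplit c b d (.u v) := by
  have h1 : 0 ≤ ∑ v ∈ V, hubSplit c b d (.old v) := Finset.sum_nonneg fun _ _ => le_max_right _ _
  have h2 : 0 < ∑ v ∈ E, hubSplit c b d (.u v) :=
    Finset.sum_pos' (fun _ _ => le_max_right _ _) ⟨v, hv, lt_max_of_lt_left (by linarith)⟩
  have h3 : hubSplit c b d .w = c := rfl
  linarith

theorem continuous_hubSplit {α Y : Type*} [TopologicalSpace Y] {c : Y → ℝ} {b d : Y → α → ℝ}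
    (hc : Continuous c) (hb : ∀ v, Continuous fun y => b y v)
    (hd : ∀ v, Continuous fun y => d y v) : Continuous fun y => hubSplit (c y) (b y) (d y) := by
  refine continuous_pi ?_
  rintro (v | _ | v)
  · exact ((hb v).sub (hd v)).max continuous_const
  · exact hc
  · exact ((hd v).sub (hb v)).max continuous_const

/-! ### The two maps -/

/-- The smallest coordinate of `x` at an old vertex of the edge `E`. -/
noncomputable def edgeMin {α : Type*} (E : Finset α) (hE : E.Nonempty)
    (x : EdgeExpansionVertex α → ℝ) : ℝ :=
  E.inf' hE fun v => x (.old v)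

theorem continuous_edgeMin {α : Type*} (E : Finset α) (hE : E.Nonempty) :
    Continuous (edgeMin E hE) :=
  Continuous.finset_inf'_apply hE fun v _ => continuous_apply (EdgeExpansionVertex.old v)

theorem edgeMin_le {α : Type*} {E : Finset α} (hE : E.Nonempty)
    (x : EdgeExpansionVertex α → ℝ) {v : α} (hv : v ∈ E) : edgeMin E hE x ≤ x (.old v) :=
  Finset.inf'_le _ hv

theorem exists_edgeMin_eq {α : Type*} {E : Finset α} (hE : E.Nonempty)
    (x : EdgeExpansionVertex α → ℝ) : ∃ v ∈ E, edgeMin E hE x = x (.old v) :=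
  Finset.exists_mem_eq_inf' hE _

theorem edgeMin_nonneg {α : Type*} {E : Finset α} (hE : E.Nonempty)
    {x : EdgeExpansionVertex α → ℝ} (hx : ∀ y, 0 ≤ x y) : 0 ≤ edgeMin E hE x :=
  Finset.le_inf' _ _ fun _ _ => hx _

open Classical in
/-- The function with value `c` on `E` and `0` elsewhere. -/
noncomputable def constOn {α : Type*} (E : Finset α) (c : ℝ) (v : α) : ℝ := if v ∈ E then c else 0

theorem constOn_of_mem {α : Type*} {E : Finset α} {v : α} (hv : v ∈ E) (c : ℝ) :
    constOn E c v = c := if_pos hv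

theorem constOn_of_notMem {α : Type*} {E : Finset α} {v : α} (hv : v ∉ E) (c : ℝ) :
    constOn E c v = 0 := if_neg hv

theorem constOn_zero {α : Type*} (E : Finset α) (v : α) : constOn E 0 v = 0 := ite_self 0

theorem constOn_nonneg {α : Type*} (E : Finset α) {c : ℝ} (hc : 0 ≤ c) (v : α) :
    0 ≤ constOn E c v := by
  unfold constOn
  split_ifs
  exacts [hc, le_rfl]

theorem continuous_constOn {α Y : Type*} [TopologicalSpace Y] (E : Finset α) {c : Y → ℝ}
    (hc : Continuous c) (v : α) : Continuous fun y => constOn E (c y) v := by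
  unfold constOn
  split_ifs
  exacts [hc, continuous_const]

theorem sum_constOn {α : Type*} {V E : Finset α} (hEV : E ⊆ V) (c : ℝ) :
    ∑ v ∈ V, constOn E c v = E.card * c := by
  rw [← Finset.sum_subset hEV fun v _ hv => constOn_of_notMem hv c,
    Finset.sum_congr rfl fun v hv => constOn_of_mem hv c, Finset.sum_const, nsmul_eq_mul]

theorem constOn_edgeMin_le {α : Type*} {E : Finset α} (hE : E.Nonempty)
    {x : EdgeExpansionVertex α → ℝ} (hx : ∀ y, 0 ≤ x y) (v : α) :
    constOn E (edgeMin E hE x) v ≤ x (.old v) := by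
  by_cases hv : v ∈ E
  · rw [constOn_of_mem hv]
    exact edgeMin_le hE x hv
  · rw [constOn_of_notMem hv]
    exact hx _

/-- The map to the suspension. Subtracting the minimum over the edge makes the old coordinates
vanish somewhere on the edge; the removed mass is moved to the hub. The height is the mass of the
spokes minus the new mass of the hub. -/
noncomputable def toSuspension {α : Type*} (E : Finset α) (hE : E.Nonempty)
    (x : EdgeExpansionVertex α → ℝ) : (α → ℝ) × ℝ :=
  (fun v => x (.old v) - constOn E (edgeMin E hE x) v,
    ∑ v ∈ E, x (.u v) - x .w - E.card * edgeMin E hE x)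

theorem continuous_toSuspension {α : Type*} (E : Finset α) (hE : E.Nonempty) :
    Continuous (toSuspension E hE) := by
  have hm := continuous_edgeMin E hE
  refine Continuous.prodMk (continuous_pi fun v => ?_) ?_
  · exact (continuous_apply _).sub (continuous_constOn E hm v)
  · fun_prop

/-- The map from the suspension, up to normalization: the lower half is the cone with apex the
hub; in the upper half a multiple of the indicator of the edge is subtracted, and what becomes
negative is moved to the spokes. -/
noncomputable def ofSuspension {α : Type*} (E : Finset α) (p : (α → ℝ) × ℝ) :
    EdgeExpansionVertex α → ℝ :=
  hubSplit (max (-p.2) 0) p.1 (constOn E (max p.2 0))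

theorem continuous_ofSuspension {α : Type*} (E : Finset α) :
    Continuous (ofSuspension E) :=
  continuous_hubSplit (by fun_prop) (fun v => by fun_prop)
    (continuous_constOn E (by fun_prop))

/-- On the edge expansion either no spoke carries mass, or the hub carries none and some vertex
of the edge carries none. -/
theorem spokes_eq_zero_or {α : Type*} {H : Hypergraph α} {E : Finset α}
    (hE : (E : Set α) ∈ H.edgeSet) (hEne : E.Nonempty) {x : EdgeExpansionVertex α → ℝ}
    (hx : x ∈ (H.edgeExpansion E).faceCone) :
    (∀ v, x (.u v) = 0) ∨ (x .w = 0 ∧ edgeMin E hEne x = 0 ∧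
      ∃ v ∈ E, 0 < x (.u v) ∧ x (.old v) = 0) := by
  obtain ⟨h0, -, hu, -, hw, huv⟩ := (mem_faceCone_edgeExpansion_iff hE).1 hx
  by_cases h : ∀ v, x (.u v) = 0
  · exact Or.inl h
  push Not at h
  obtain ⟨v, hv⟩ := h
  have hvE : v ∈ E := by
    by_contra hvE
    exact hv (hu v hvE)
  have hold := (huv v hvE).resolve_left hv
  exact Or.inr ⟨(hw v hvE).resolve_right hv,
    le_antisymm (hold ▸ edgeMin_le hEne x hvE) (edgeMin_nonneg hEne h0),
    v, hvE, (h0 _).lt_of_ne' hv, hold⟩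

theorem toSuspension_mem {α : Type*} {H : Hypergraph α} {V E : Finset α}
    (hV : (V : Set α) = H.vertexSet) (hE : (E : Set α) ∈ H.edgeSet) (hEne : E.Nonempty)
    {x : EdgeExpansionVertex α → ℝ} (hx : x ∈ (H.edgeExpansion E).faceCone)
    (hsum : ∑ v ∈ V, x (.old v) + x .w + ∑ v ∈ E, x (.u v) = 1) :
    toSuspension E hEne x ∈ H.suspensionModel V := by
  obtain ⟨h0, hold, -, hedge, -, -⟩ := (mem_faceCone_edgeExpansion_iff hE).1 hx
  have hEV : E ⊆ V := by
    have := H.subset_vertexSet_of_mem_edgeSet' hE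
    rw [← hV] at this
    exact_mod_cast this
  have hm := edgeMin_nonneg hEne h0
  have hzero : ∀ v, x (.old v) = 0 → x (.old v) - constOn E (edgeMin E hEne x) v = 0 := by
    intro v hv
    have h1 := constOn_edgeMin_le hEne h0 v
    have h2 := constOn_nonneg E hm v
    linarith
  refine ⟨⟨fun v => sub_nonneg.2 (constOn_edgeMin_le hEne h0 v),
    fun v hv => hzero v (hold v hv), fun f hf => ?_⟩, ?_⟩
  · by_cases hfE : f = E
    · subst hfE
      obtain ⟨v, hv, h⟩ := exists_edgeMin_eq hEne x
      refine ⟨v, hv, ?_⟩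
      simp only [toSuspension, constOn_of_mem hv, h, sub_self]
    · obtain ⟨v, hv, h⟩ := hedge f hf hfE
      exact ⟨v, hv, hzero v h⟩
  · simp only [toSuspension, Finset.sum_sub_distrib, sum_constOn hEV]
    rcases spokes_eq_zero_or hE hEne hx with h | ⟨hw0, hm0, -⟩
    · simp only [h, Finset.sum_const_zero, add_zero] at hsum ⊢
      have : 0 ≤ x .w := h0 _
      rw [abs_of_nonpos (by nlinarith [(Nat.cast_nonneg E.card : (0 : ℝ) ≤ E.card)])]
      linarith
    · simp only [hw0, hm0] at hsum ⊢
      have : 0 ≤ ∑ v ∈ E, x (.u v) := Finset.sum_nonneg fun v _ => h0 _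
      rw [abs_of_nonneg (by linarith)]
      linarith

theorem ofSuspension_mem_faceCone {α : Type*} {H : Hypergraph α} {V E : Finset α}
    (hE : (E : Set α) ∈ H.edgeSet) {p : (α → ℝ) × ℝ} (hp : p ∈ H.suspensionModel V) :
    ofSuspension E p ∈ (H.edgeExpansion E).faceCone := by
  obtain ⟨⟨h0, hoff, hedge⟩, -⟩ := hp
  refine hubSplit_mem_faceCone hE (le_max_right _ _) h0 (constOn_nonneg E (le_max_right _ _))
    hoff (fun v hv => constOn_of_notMem hv _) (fun f hf _ => hedge f hf) ?_
  rcases le_total p.2 0 with h | h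
  · right
    intro v
    rw [max_eq_right h, constOn_zero]
    exact h0 v
  · exact Or.inl (max_eq_right (by linarith))

theorem ofSuspension_sum_pos {α : Type*} {H : Hypergraph α} {V E : Finset α}
    (hE : (E : Set α) ∈ H.edgeSet) {p : (α → ℝ) × ℝ} (hp : p ∈ H.suspensionModel V) :
    0 < ∑ v ∈ V, ofSuspension E p (.old v) + ofSuspension E p .w +
      ∑ v ∈ E, ofSuspension E p (.u v) := by
  obtain ⟨⟨h0, -, hedge⟩, hsum⟩ := hp
  rcases le_or_gt p.2 0 with h | h
  · have h1 : ∀ v, ofSuspension E p (.old v) = p.1 v := by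
      intro v
      simp only [ofSuspension, hubSplit, max_eq_right h, constOn_zero, sub_zero, h0 v, max_eq_left]
    have h2 : ofSuspension E p .w = -p.2 := max_eq_left (by linarith)
    have h3 : 0 ≤ ∑ v ∈ E, ofSuspension E p (.u v) :=
      Finset.sum_nonneg fun v _ => le_max_right _ _
    simp only [h1, h2, hsum, abs_of_nonpos h]
    linarith
  · obtain ⟨v, hv, hv0⟩ := hedge _ hE
    refine hubSplit_sum_pos (le_max_right _ _) hv ?_
    rw [hv0, constOn_of_mem hv]
    exact lt_max_of_lt_left h

/-! ### The two homotopies -/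

/-- The path, up to normalization, from `x` (at `s = 0`) to its image under the composition
through the suspension (at `s = 1`). -/
noncomputable def expansionPath {α : Type*} (E : Finset α) (hE : E.Nonempty) (s : ℝ)
    (x : EdgeExpansionVertex α → ℝ) : EdgeExpansionVertex α → ℝ :=
  hubSplit (x .w + s * (E.card * edgeMin E hE x)) (fun v => x (.old v)) fun v =>
    constOn E (s * edgeMin E hE x) v + (1 - s) * x (.u v) + constOn E (s * ∑ v ∈ E, x (.u v)) v

theorem continuous_expansionPath {α : Type*} (E : Finset α) (hE : E.Nonempty) :
    Continuous fun q : ℝ × (EdgeExpansionVertex α → ℝ) => expansionPath E hE q.1 q.2 := by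
  have hm : Continuous fun q : ℝ × (EdgeExpansionVertex α → ℝ) => edgeMin E hE q.2 :=
    (continuous_edgeMin E hE).comp continuous_snd
  refine continuous_hubSplit (by fun_prop) (fun v => by fun_prop) fun v => ?_
  refine ((continuous_constOn E (by fun_prop) v).add (by fun_prop)).add
    (continuous_constOn E (by fun_prop) v)

theorem expansionPath_zero {α : Type*} {H : Hypergraph α} {E : Finset α}
    (hE : (E : Set α) ∈ H.edgeSet) (hEne : E.Nonempty) {x : EdgeExpansionVertex α → ℝ}
    (hx : x ∈ (H.edgeExpansion E).faceCone) : expansionPath E hEne 0 x = x := by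
  obtain ⟨h0, -, hu, -, -, huv⟩ := (mem_faceCone_edgeExpansion_iff hE).1 hx
  have huv' : ∀ v, x (.u v) = 0 ∨ x (.old v) = 0 := fun v => by
    by_cases hv : v ∈ E
    exacts [huv v hv, Or.inl (hu v hv)]
  funext y
  rcases y with v | _ | v
  · simp only [expansionPath, hubSplit, zero_mul, constOn_zero]
    rcases huv' v with h | h
    · simp [h, h0]
    · simp [h, h0]
  · simp [expansionPath, hubSplit]
  · simp only [expansionPath, hubSplit, zero_mul, constOn_zero]
    rcases huv' v with h | h
    · simp [h, h0]
    · simp [h, h0]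

theorem expansionPath_one {α : Type*} {H : Hypergraph α} {E : Finset α}
    (hE : (E : Set α) ∈ H.edgeSet) (hEne : E.Nonempty) {x : EdgeExpansionVertex α → ℝ}
    (hx : x ∈ (H.edgeExpansion E).faceCone) :
    expansionPath E hEne 1 x = ofSuspension E (toSuspension E hEne x) := by
  have h0 := hx.1
  have hm := edgeMin_nonneg hEne h0
  have hcm : 0 ≤ E.card * edgeMin E hEne x := mul_nonneg (Nat.cast_nonneg _) hm
  have hw0 := h0 .w
  rcases spokes_eq_zero_or hE hEne hx with h | ⟨hw, hm0, -⟩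
  · have h1 : max (-(0 - x .w - E.card * edgeMin E hEne x)) 0 =
        x .w + E.card * edgeMin E hEne x := by
      rw [max_eq_left] <;> linarith
    have h2 : max (0 - x .w - E.card * edgeMin E hEne x) 0 = 0 := max_eq_right (by linarith)
    funext y
    rcases y with v | _ | v
    · simp only [expansionPath, ofSuspension, toSuspension, hubSplit, h, Finset.sum_const_zero, h2,
        constOn_zero, one_mul, mul_zero, add_zero, sub_zero]
    · simp only [expansionPath, ofSuspension, toSuspension, hubSplit, h, Finset.sum_const_zero, h1,
        one_mul]
    · simp only [expansionPath, ofSuspension, toSuspension, hubSplit, h, Finset.sum_const_zero, h2,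
        constOn_zero, one_mul, mul_zero, add_zero]
      congr 1
      ring
  · have h1 : 0 ≤ ∑ v ∈ E, x (.u v) := Finset.sum_nonneg fun v _ => h0 _
    funext y
    rcases y with v | _ | v <;>
    simp [expansionPath, ofSuspension, toSuspension, hubSplit, hw, hm0, constOn_zero, h1]

theorem expansionPath_mem_faceCone {α : Type*} {H : Hypergraph α} {E : Finset α}
    (hE : (E : Set α) ∈ H.edgeSet) (hEne : E.Nonempty) {s : ℝ} (hs : s ∈ Set.Icc (0 : ℝ) 1)
    {x : EdgeExpansionVertex α → ℝ} (hx : x ∈ (H.edgeExpansion E).faceCone) :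
    expansionPath E hEne s x ∈ (H.edgeExpansion E).faceCone := by
  obtain ⟨h0, hold, hu, hedge, -, -⟩ := (mem_faceCone_edgeExpansion_iff hE).1 hx
  have hm := edgeMin_nonneg hEne h0
  have hcm : 0 ≤ E.card * edgeMin E hEne x := mul_nonneg (Nat.cast_nonneg _) hm
  have hsum : 0 ≤ ∑ v ∈ E, x (.u v) := Finset.sum_nonneg fun v _ => h0 _
  refine hubSplit_mem_faceCone hE (add_nonneg (h0 _) (mul_nonneg hs.1 hcm)) (fun v => h0 _)
    (fun v => ?_) hold (fun v hv => ?_) hedge ?_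
  · exact add_nonneg (add_nonneg (constOn_nonneg E (mul_nonneg hs.1 hm) v)
      (mul_nonneg (sub_nonneg.2 hs.2) (h0 _))) (constOn_nonneg E (mul_nonneg hs.1 hsum) v)
  · simp [constOn_of_notMem hv, hu v hv]
  · rcases spokes_eq_zero_or hE hEne hx with h | ⟨hw, hm0, -⟩
    · right
      intro v
      simp only [h, Finset.sum_const_zero, mul_zero, constOn_zero, add_zero]
      by_cases hv : v ∈ E
      · rw [constOn_of_mem hv]
        exact (mul_le_of_le_one_left hm hs.2).trans (edgeMin_le hEne x hv)
      · rw [constOn_of_notMem hv]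
        exact h0 _
    · left
      simp [hw, hm0]

theorem expansionPath_sum_pos {α : Type*} {H : Hypergraph α} {V E : Finset α}
    (hV : (V : Set α) = H.vertexSet) (hE : (E : Set α) ∈ H.edgeSet) (hEne : E.Nonempty)
    {s : ℝ} (hs : s ∈ Set.Icc (0 : ℝ) 1)
    {x : EdgeExpansionVertex α → ℝ} (hx : x ∈ (H.edgeExpansion E).faceCone)
    (hsum : ∑ v ∈ V, x (.old v) + x .w + ∑ v ∈ E, x (.u v) = 1) :
    0 < ∑ v ∈ V, expansionPath E hEne s x (.old v) + expansionPath E hEne s x .w +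
      ∑ v ∈ E, expansionPath E hEne s x (.u v) := by
  have h0 := hx.1
  have hm := edgeMin_nonneg hEne h0
  have hcm : 0 ≤ E.card * edgeMin E hEne x := mul_nonneg (Nat.cast_nonneg _) hm
  have hEV : E ⊆ V := by
    have := H.subset_vertexSet_of_mem_edgeSet' hE
    rw [← hV] at this
    exact_mod_cast this
  rcases spokes_eq_zero_or hE hEne hx with h | ⟨hw, hm0, v, hv, hpos, hold⟩
  · -- Without spokes, the mass taken from the old vertices is exactly what the hub receives.
    have h1 : ∑ v ∈ V, x (.old v) - s * (E.card * edgeMin E hEne x) ≤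
        ∑ v ∈ V, expansionPath E hEne s x (.old v) := by
      have : s * (E.card * edgeMin E hEne x) = ∑ v ∈ V, constOn E (s * edgeMin E hEne x) v := by
        rw [sum_constOn hEV]
        ring
      rw [this, ← Finset.sum_sub_distrib]
      refine Finset.sum_le_sum fun v _ => ?_
      simp only [expansionPath, hubSplit, h, Finset.sum_const_zero, mul_zero, constOn_zero,
        add_zero]
      exact le_max_left _ _
    have h2 : expansionPath E hEne s x .w = x .w + s * (E.card * edgeMin E hEne x) := rfl
    have h3 : 0 ≤ ∑ v ∈ E, expansionPath E hEne s x (.u v) :=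
      Finset.sum_nonneg fun v _ => le_max_right _ _
    simp only [h, Finset.sum_const_zero, add_zero] at hsum
    linarith
  · -- The old vertex `v` carries no mass and its spoke does, so `b - d` is negative at `v`.
    refine hubSplit_sum_pos (add_nonneg (h0 _) (mul_nonneg hs.1 hcm)) hv ?_
    have hS : x (.u v) ≤ ∑ v ∈ E, x (.u v) :=
      Finset.single_le_sum (f := fun v => x (.u v)) (fun v _ => h0 _) hv
    simp only [hold, hm0, constOn_of_mem hv]
    nlinarith [hs.1]

/-- The coordinate model contains the segment between two of its points in the same half, if the
support of the second is contained in the support of the first. -/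
theorem segment_mem_suspensionModel {α : Type*} {H : Hypergraph α} {V : Finset α}
    {p q : (α → ℝ) × ℝ} (hp : p ∈ H.suspensionModel V) (hq : q ∈ H.suspensionModel V)
    (hsupp : ∀ v, p.1 v = 0 → q.1 v = 0) (hpq : (p.2 ≤ 0 ∧ q.2 ≤ 0) ∨ (0 ≤ p.2 ∧ 0 ≤ q.2))
    {s : ℝ} (hs : s ∈ Set.Icc (0 : ℝ) 1) : (1 - s) • p + s • q ∈ H.suspensionModel V := by
  have hs1 : 0 ≤ 1 - s := sub_nonneg.2 hs.2
  constructor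
  · refine mem_faceCone_of_support hp.1 (fun v => ?_) fun v hv => ?_
    · exact add_nonneg (mul_nonneg hs1 (hp.1.1 v)) (mul_nonneg hs.1 (hq.1.1 v))
    · simp [hv, hsupp v hv]
  · simp only [Prod.fst_add, Prod.smul_fst, Pi.add_apply, Pi.smul_apply, smul_eq_mul,
      Finset.sum_add_distrib, ← Finset.mul_sum, hp.2, hq.2, Prod.snd_add, Prod.smul_snd]
    rcases hpq with ⟨h1, h2⟩ | ⟨h1, h2⟩
    · rw [abs_of_nonpos h1, abs_of_nonpos h2, abs_of_nonpos]
      · ring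
      · nlinarith [mul_nonneg hs1 (neg_nonneg.2 h1), mul_nonneg hs.1 (neg_nonneg.2 h2)]
    · rw [abs_of_nonneg h1, abs_of_nonneg h2, abs_of_nonneg]
      · ring
      · exact add_nonneg (mul_nonneg hs1 h1) (mul_nonneg hs.1 h2)

/-- Going to the edge expansion and back neither enlarges the support nor changes the half of the
suspension. -/
theorem toSuspension_smul_ofSuspension {α : Type*} {H : Hypergraph α} {V E : Finset α}
    (hE : (E : Set α) ∈ H.edgeSet) (hEne : E.Nonempty) {p : (α → ℝ) × ℝ}
    (hp : p ∈ H.suspensionModel V) {c : ℝ} (hc : 0 ≤ c) :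
    (∀ v, p.1 v = 0 → (toSuspension E hEne (c • ofSuspension E p)).1 v = 0) ∧
      ((p.2 ≤ 0 ∧ (toSuspension E hEne (c • ofSuspension E p)).2 ≤ 0) ∨
        (0 ≤ p.2 ∧ 0 ≤ (toSuspension E hEne (c • ofSuspension E p)).2)) := by
  have hx := smul_mem_faceCone (ofSuspension_mem_faceCone hE hp) hc
  obtain ⟨⟨h0, -, hedge⟩, -⟩ := hp
  have hm := edgeMin_nonneg hEne hx.1
  -- Old vertices outside the support of `p` carry no mass.
  have hold : ∀ v, p.1 v = 0 → (c • ofSuspension E p) (.old v) = 0 := by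
    intro v hv
    have : ofSuspension E p (.old v) = 0 := by
      refine max_eq_right ?_
      rw [hv, zero_sub]
      exact neg_nonpos.2 (constOn_nonneg E (le_max_right _ _) v)
    simp [this]
  -- Some vertex of the edge lies outside the support of `p`.
  have hm0 : edgeMin E hEne (c • ofSuspension E p) = 0 := by
    obtain ⟨v, hv, hv0⟩ := hedge _ hE
    exact le_antisymm (hold v hv0 ▸ edgeMin_le hEne _ hv) hm
  constructor
  · intro v hv
    simp only [toSuspension, hm0, constOn_zero, hold v hv, sub_zero]
  · simp only [toSuspension, hm0, mul_zero, sub_zero]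
    rcases le_total p.2 0 with h | h
    · refine Or.inl ⟨h, ?_⟩
      have hu : ∀ v, ofSuspension E p (.u v) = 0 := by
        intro v
        simp only [ofSuspension, hubSplit, max_eq_right h, constOn_zero, zero_sub]
        exact max_eq_right (neg_nonpos.2 (h0 v))
      have hw := hx.1 .w
      simp only [Pi.smul_apply, hu, smul_zero, Finset.sum_const_zero, zero_sub] at hw ⊢
      exact neg_nonpos.2 hw
    · refine Or.inr ⟨h, ?_⟩
      have hw : ofSuspension E p .w = 0 := max_eq_right (neg_nonpos.2 h)
      simp only [Pi.smul_apply, hw, smul_zero, sub_zero]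
      exact Finset.sum_nonneg fun v _ => hx.1 (.u v)

theorem nonempty_homotopyEquiv_suspensionModel {α : Type*} {H : Hypergraph α} {V E : Finset α}
    (hV : (V : Set α) = H.vertexSet) (hE : (E : Set α) ∈ H.edgeSet) (hEne : E.Nonempty) :
    Nonempty (ContinuousMap.HomotopyEquiv
      (H.edgeExpansion E).independenceComplex.realization (H.suspensionModel V)) := by
  obtain ⟨W, hW, hsumW⟩ := exists_finset_vertexSet_edgeExpansion hV hE
  have hX : ∀ x, x ∈ (H.edgeExpansion E).independenceComplex.realization ↔
      x ∈ (H.edgeExpansion E).faceCone ∧ ∑ y ∈ W, x y = 1 := fun x =>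
    mem_realization_independenceComplex_iff hW
  have hofpos : ∀ p : H.suspensionModel V, 0 < ∑ y ∈ W, ofSuspension E p y := fun p => by
    rw [hsumW]
    exact ofSuspension_sum_pos hE p.2
  have hfmem : ∀ x : (H.edgeExpansion E).independenceComplex.realization,
      toSuspension E hEne x ∈ H.suspensionModel V := fun x => by
    obtain ⟨hx, hsum⟩ := (hX x).1 x.2
    rw [hsumW] at hsum
    exact toSuspension_mem hV hE hEne hx hsum
  let f : C((H.edgeExpansion E).independenceComplex.realization, H.suspensionModel V) :=
    ⟨fun x => ⟨toSuspension E hEne x, hfmem x⟩,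
      ((continuous_toSuspension E hEne).comp continuous_subtype_val).subtype_mk hfmem⟩
  let g : C(H.suspensionModel V, (H.edgeExpansion E).independenceComplex.realization) :=
    ⟨fun p => ⟨(∑ y ∈ W, ofSuspension E p y)⁻¹ • ofSuspension E p,
        normalize_mem_realization hW (ofSuspension_mem_faceCone hE p.2) (hofpos p)⟩, by
      have hc : Continuous fun p : H.suspensionModel V => ofSuspension E p :=
        (continuous_ofSuspension E).comp continuous_subtype_val
      refine Continuous.subtype_mk (Continuous.smul (Continuous.inv₀ ?_ fun p => (hofpos p).ne')
        hc) _
      exact continuous_finsetSum _ fun y _ => (continuous_apply y).comp hc⟩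
  have hpath : ∀ (s : unitInterval) (x : (H.edgeExpansion E).independenceComplex.realization),
      0 < ∑ y ∈ W, expansionPath E hEne s x y := fun s x => by
    obtain ⟨hx, hsum⟩ := (hX x).1 x.2
    rw [hsumW] at hsum ⊢
    exact expansionPath_sum_pos hV hE hEne s.2 hx hsum
  have hgf : (ContinuousMap.id _).Homotopic (g.comp f) := by
    have hc : Continuous fun q : unitInterval ×
        (H.edgeExpansion E).independenceComplex.realization =>
          expansionPath E hEne q.1 (q.2 : EdgeExpansionVertex α → ℝ) :=
      (continuous_expansionPath E hEne).comp
        ((continuous_subtype_val.comp continuous_fst).prodMk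
          (continuous_subtype_val.comp continuous_snd))
    refine ⟨⟨⟨fun q => ⟨(∑ y ∈ W, expansionPath E hEne q.1 q.2 y)⁻¹ •
        expansionPath E hEne q.1 q.2, normalize_mem_realization hW
          (expansionPath_mem_faceCone hE hEne q.1.2 ((hX _).1 q.2.2).1) (hpath q.1 q.2)⟩, ?_⟩,
      fun x => ?_, fun x => ?_⟩⟩
    · refine Continuous.subtype_mk (Continuous.smul (Continuous.inv₀ ?_
        fun q => (hpath q.1 q.2).ne') hc) _
      exact continuous_finsetSum _ fun y _ => (continuous_apply y).comp hc
    · obtain ⟨hx, hsum⟩ := (hX x).1 x.2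
      refine Subtype.ext ?_
      simp [expansionPath_zero hE hEne hx, hsum]
    · refine Subtype.ext ?_
      simp [expansionPath_one hE hEne ((hX x).1 x.2).1, f, g]
  have hfg : (ContinuousMap.id _).Homotopic (f.comp g) := by
    have hmem : ∀ (s : unitInterval) (p : H.suspensionModel V),
        (1 - (s : ℝ)) • (p : (α → ℝ) × ℝ) + (s : ℝ) • (f (g p) : (α → ℝ) × ℝ) ∈
          H.suspensionModel V := fun s p => by
      obtain ⟨h1, h2⟩ := toSuspension_smul_ofSuspension hE hEne p.2
        (inv_nonneg.2 (hofpos p).le)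
      exact segment_mem_suspensionModel p.2 (f (g p)).2 h1 h2 s.2
    refine ⟨⟨⟨fun q => ⟨_, hmem q.1 q.2⟩, ?_⟩, fun p => ?_, fun p => ?_⟩⟩
    · exact Continuous.subtype_mk (by fun_prop) _
    · exact Subtype.ext (by simp)
    · exact Subtype.ext (by simp)
  exact ⟨⟨f, g, hgf.symm, hfg.symm⟩⟩

end Hypergraph

theorem lemma5p1 {α : Type*} (H : Hypergraph α) (hfin : H.vertexSet.Finite)
    (hne : ∅ ∉ H.edgeSet) (e : Set α) (he : e ∈ H.edgeSet) :
    Nonempty (ContinuousMap.HomotopyEquiv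
      (H.edgeExpansion e).independenceComplex.realization
      (Suspension H.independenceComplex.realization)) := by
  obtain ⟨V, hV⟩ := hfin.exists_finset_coe
  obtain ⟨E, rfl⟩ := (hfin.subset (H.subset_vertexSet_of_mem_edgeSet' he)).exists_finset_coe
  have hE : E.Nonempty := Finset.nonempty_iff_ne_empty.2 fun h => hne (by simpa [h] using he)
  obtain ⟨φ⟩ := Hypergraph.nonempty_homotopyEquiv_suspensionModel hV he hE
  obtain ⟨ψ⟩ := Hypergraph.nonempty_homeomorph_suspensionModel hV hne
  exact ⟨φ.trans ψ.symm.toHomotopyEquiv⟩
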